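/- Let $\rho_0,\rho_1$ be density operators (positive semidefinite, trace one) on a finite-dimensional complex Hilbert space, and suppose that $\ker\rho_1\subseteq\ker\rho_0$ (for instance, that both are invertible). A POVM is a finite family $\{E_b\}_{b=1}^n$, with any number $n$ of outcomes, of positive semidefinite operators with $\sum_b E_b=1$. For a POVM put $p_i(b)=\mathrm{tr}(\rho_iE_b)$ and $$K(p_0/p_1)=\sum_b p_0(b)\ln\frac{p_0(b)}{p_1(b)}$$ (terms with $p_0(b)=0$ count as $0$). Define the quantum Kullback information $K(\rho_0/\rho_1)=\sup_{\{E_b\}}K(p_0/p_1)$, the supremum over all POVMs, and the Umegaki relative information $K_{\rm U}(\rho_0/\rho_1)=\mathrm{tr}(\rho_0\ln\rho_0-\rho_0\ln\rho_1)$, where $0\ln 0=0$ and $\ln\rho_1$ is taken on the support of $\rho_1$. Then: 1. for every POVM, $K(p_0/p_1)\le K_{\rm U}(\rho_0/\rho_1)$; 2. consequently $K(\rho_0/\rho_1)\le K_{\rm U}(\rho_0/\rho_1)$; 3. $K(\rho_0/\rho_1)=K_{\rm U}(\rho_0/\rho_1)$ if and only if $\rho_0$ and $\rho_1$ commute; 4.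 some POVM attains $K(p_0/p_1)=K_{\rm U}(\rho_0/\rho_1)$ if and only if $\rho_0$ and $\rho_1$ commute. -/

import Mathlib

open scoped ComplexOrder

/-- A density operator on the finite-dimensional Hilbert space `ℂ^d`: a positive semidefinite
matrix of trace one. -/
structure DensityMatrix (d : Type*) [Fintype d] where
  /-- the underlying matrix -/
  mat : Matrix d d ℂ
  posSemidef : mat.PosSemidef
  trace_eq_one : mat.trace = 1

/-- A POVM on `ℂ^d` with `n` outcomes: positive semidefinite matrices `E b` that sum to the
identity. -/
structure POVM (d : Type*) [Fintype d] [DecidableEq d] (n : ℕ) where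
  /-- the operator that belongs to the outcome `b` -/
  effect : Fin n → Matrix d d ℂ
  posSemidef : ∀ b, (effect b).PosSemidef
  sum_eq_one : ∑ b, effect b = 1

/-- The outcome distribution `p(b) = tr (ρ E_b)`; the trace is a real number, recorded by its
real part. -/
noncomputable def POVM.prob {d : Type*} [Fintype d] [DecidableEq d] {n : ℕ}
    (E : POVM d n) (ρ : DensityMatrix d) (b : Fin n) : ℝ :=
  (ρ.mat * E.effect b).trace.re

/-- The Kullback-Leibler relative information `K(p/q) = ∑_b p(b) ln (p(b)/q(b))`. Terms with
`p(b) = 0` vanish; the value is meaningful when `q(b) = 0` implies `p(b) = 0`. -/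
noncomputable def klInformation {n : ℕ} (p q : Fin n → ℝ) : ℝ :=
  ∑ b, p b * Real.log (p b / q b)

/-- The quantum Kullback information `K(ρ₀/ρ₁)`: the supremum over all POVMs, with any finite
number of outcomes, of the Kullback-Leibler information of the outcome distributions. -/
noncomputable def quantumKullback {d : Type*} [Fintype d] [DecidableEq d]
    (ρ₀ ρ₁ : DensityMatrix d) : ℝ :=
  sSup {x : ℝ | ∃ (n : ℕ) (E : POVM d n), x = klInformation (E.prob ρ₀) (E.prob ρ₁)}

/-- The Umegaki relative information `K_U(ρ₀/ρ₁) = tr (ρ₀ ln ρ₀ - ρ₀ ln ρ₁)`. The logarithm is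
that of the functional calculus; since `Real.log 0 = 0`, it is the logarithm on the support and
zero on the kernel, which gives `0 ln 0 = 0` in the first term and the usual value of the second
term when `ker ρ₁ ⊆ ker ρ₀`. -/
noncomputable def umegakiInformation {d : Type*} [Fintype d] [DecidableEq d]
    (ρ₀ ρ₁ : DensityMatrix d) : ℝ :=
  (ρ₀.mat * cfc Real.log ρ₀.mat - ρ₀.mat * cfc Real.log ρ₁.mat).trace.re

/-! Both informations are integrals of chi-square quantities. With `r = t * a + (1 - t) * b`, the
derivative of `a * log r - r` in `t` is `(1 - t) * (a - b) ^ 2 / r`. Applied to the outcome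
probabilities this gives `klInformation`. Applied to eigenvalues `a i`, `b j` of the two states,
weighted by the squared overlaps of the eigenbases, it gives `umegakiInformation`. It therefore
suffices to compare chi-squares for each `t`.

Write `A = ρ₀`, `B = ρ₁`. The quantum chi-square is the maximum over all matrices `X` of a concave
quadratic functional, attained at the solution `Y` of `t * A * Y + (1 - t) * Y * B = A - B`. A POVM
supplies a Hermitian `X` at which the functional is at least the classical chi-square, since `X ^ 2
≤ ∑ c k ^ 2 • E k`. The loss is at least the weighted squared distance `deviation` from `X` to `Y`
(`POVM.exists_chiSquare_add_deviation_le`).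

Strictness comes from `t` near `0`, where `Y * B` tends to `A - B`. For Hermitian `X` the matrix `B
* X * B` is Hermitian, whereas `B * (A - B)` is Hermitian only if `A` and `B` commute. Otherwise the
deviation has a positive lower bound independent of the POVM (`exists_pos_le_deviation`), so even
the supremum falls short. If the states commute, measuring their joint spectral projections attains
the bound. -/

open Matrix

/-- The squared Hilbert-Schmidt norm of a matrix. -/
noncomputable def Matrix.hilbertSchmidtSq {d : Type*} [Fintype d] (Z : Matrix d d ℂ) : ℝ :=
  ∑ i, ∑ j, ‖Z i j‖ ^ 2

theorem Matrix.hilbertSchmidtSq_nonneg {d : Type*} [Fintype d] (Z : Matrix d d ℂ) :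
    0 ≤ Z.hilbertSchmidtSq :=
  Finset.sum_nonneg fun _ _ => Finset.sum_nonneg fun _ _ => by positivity

theorem Matrix.hilbertSchmidtSq_pos {d : Type*} [Fintype d] {Z : Matrix d d ℂ} (hZ : Z ≠ 0) :
    0 < Z.hilbertSchmidtSq := by
  refine lt_of_le_of_ne Z.hilbertSchmidtSq_nonneg fun h => hZ ?_
  ext i j
  have h1 := (Finset.sum_eq_zero_iff_of_nonneg fun i _ =>
    Finset.sum_nonneg fun j _ => by positivity).1 h.symm i (Finset.mem_univ i)
  have h2 := (Finset.sum_eq_zero_iff_of_nonneg fun j _ => by positivity).1 h1 j (Finset.mem_univ j)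
  simpa using h2

/-! ### Traces and Hilbert-Schmidt norms in eigenbases -/

section Trace

variable {d : Type*} [Fintype d] [DecidableEq d]

theorem Matrix.PosSemidef.exists_eq_conjTranspose_mul_self {A : Matrix d d ℂ} (hA : A.PosSemidef) :
    ∃ L : Matrix d d ℂ, A = Lᴴ * L := by
  open scoped MatrixOrder Matrix.Norms.L2Operator in
  exact CStarAlgebra.nonneg_iff_eq_star_mul_self.mp hA.nonneg

theorem Matrix.PosSemidef.trace_mul_nonneg {A B : Matrix d d ℂ} (hA : A.PosSemidef)
    (hB : B.PosSemidef) : 0 ≤ (A * B).trace := by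
  obtain ⟨L, rfl⟩ := hA.exists_eq_conjTranspose_mul_self
  rw [Matrix.mul_assoc, Matrix.trace_mul_comm]
  exact (hB.mul_mul_conjTranspose_same L).trace_nonneg

/-- A trace pairing of two diagonalized matrices, expanded in their eigenbases. -/
theorem Matrix.trace_diagonalized_mul_mul (U V Z W : Matrix d d ℂ) (a g : d → ℂ) :
    (U * diagonal a * Uᴴ * Z * (V * diagonal g * Vᴴ) * Wᴴ).trace =
      ∑ i, ∑ j, a i * g j * ((Uᴴ * Z * V) i j * star ((Uᴴ * W * V) i j)) := by
  have h : (U * diagonal a * Uᴴ * Z * (V * diagonal g * Vᴴ) * Wᴴ).trace =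
      (diagonal a * (Uᴴ * Z * V) * (diagonal g * (Uᴴ * W * V)ᴴ)).trace := by
    rw [conjTranspose_mul, conjTranspose_mul, conjTranspose_conjTranspose]
    simp only [Matrix.mul_assoc]
    rw [Matrix.trace_mul_comm]
    simp only [Matrix.mul_assoc]
  rw [h, Matrix.trace]
  refine Finset.sum_congr rfl fun i _ => ?_
  rw [diag_apply, Matrix.mul_apply]
  refine Finset.sum_congr rfl fun j _ => ?_
  rw [diagonal_mul, diagonal_mul, conjTranspose_apply]
  ring

theorem Matrix.hilbertSchmidtSq_conj {U V : Matrix d d ℂ} (hU : U * Uᴴ = 1) (hV : V * Vᴴ = 1)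
    (Z : Matrix d d ℂ) : (Uᴴ * Z * V).hilbertSchmidtSq = Z.hilbertSchmidtSq := by
  have h1 := trace_diagonalized_mul_mul U V Z Z 1 1
  have h2 := trace_diagonalized_mul_mul 1 1 Z Z 1 1
  have h3 (z : ℂ) : z * star z = ((‖z‖ ^ 2 : ℝ) : ℂ) := by
    simpa using Complex.mul_conj' z
  have e : (diagonal 1 : Matrix d d ℂ) = 1 := diagonal_one
  simp only [e, Matrix.mul_one, hU, hV, Pi.one_apply, one_mul,
    conjTranspose_one, h3] at h1 h2
  rw [h1] at h2
  unfold hilbertSchmidtSq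
  exact_mod_cast h2

open scoped Matrix.Norms.Frobenius in
theorem Matrix.frobenius_norm_sq (Z : Matrix d d ℂ) : ‖Z‖ ^ 2 = Z.hilbertSchmidtSq := by
  rw [frobenius_norm_def, hilbertSchmidtSq, ← Real.sqrt_eq_rpow, Real.sq_sqrt]
  · simp
  · exact Finset.sum_nonneg fun _ _ => Finset.sum_nonneg fun _ _ => by positivity

open scoped Matrix.Norms.Frobenius in
/-- The distance from `M` to the matrices `X * B`, with `X` and `B` Hermitian, is bounded below by
the anti-Hermitian part of `B * M`. -/
theorem Matrix.IsHermitian.hilbertSchmidtSq_sub_conjTranspose_le {X B : Matrix d d ℂ}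
    (hX : X.IsHermitian) (hB : B.IsHermitian) (M : Matrix d d ℂ) :
    (B * M - Mᴴ * B).hilbertSchmidtSq ≤
      4 * B.hilbertSchmidtSq * (X * B - M).hilbertSchmidtSq := by
  set P := B * (X * B - M)
  -- The Hermitian term `B * X * B` cancels in `Pᴴ - P`.
  have e : B * M - Mᴴ * B = Pᴴ - P := by
    simp only [P, conjTranspose_mul, conjTranspose_sub, hX.eq, hB.eq]
    noncomm_ring
  have h1 : ‖B * M - Mᴴ * B‖ ≤ 2 * (‖B‖ * ‖X * B - M‖) := by
    rw [e]
    refine (norm_sub_le _ _).trans ?_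
    rw [frobenius_norm_conjTranspose]
    linarith [frobenius_norm_mul B (X * B - M)]
  rw [← frobenius_norm_sq, ← frobenius_norm_sq, ← frobenius_norm_sq]
  calc _ ≤ (2 * (‖B‖ * ‖X * B - M‖)) ^ 2 := by gcongr
    _ = _ := by ring

theorem Matrix.IsHermitian.exists_cfc_eq {A : Matrix d d ℂ} (hA : A.IsHermitian) :
    ∃ (U : Matrix d d ℂ) (a : d → ℝ), U * Uᴴ = 1 ∧ Uᴴ * U = 1 ∧
      A = U * diagonal (fun i => (a i : ℂ)) * Uᴴ ∧
      ∀ f : ℝ → ℝ, cfc f A = U * diagonal (fun i => (f (a i) : ℂ)) * Uᴴ := by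
  refine ⟨hA.eigenvectorUnitary, hA.eigenvalues, ?_, ?_, ?_, fun f => ?_⟩
  · exact Unitary.coe_mul_star_self _
  · exact Unitary.coe_star_mul_self _
  · exact hA.spectral_theorem
  · rw [hA.cfc_eq]
    rfl

end Trace

/-! ### Outcome probabilities and observables of a POVM -/

section Measurement

variable {d : Type*} [Fintype d] [DecidableEq d] {n : ℕ}

theorem POVM.prob_nonneg (E : POVM d n) (ρ : DensityMatrix d) (k : Fin n) : 0 ≤ E.prob ρ k :=
  (Complex.nonneg_iff.1 (ρ.posSemidef.trace_mul_nonneg (E.posSemidef k))).1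

theorem POVM.sum_prob (E : POVM d n) (ρ : DensityMatrix d) : ∑ k, E.prob ρ k = 1 := by
  simp only [POVM.prob, ← Complex.re_sum, ← trace_sum, ← Matrix.mul_sum, E.sum_eq_one,
    Matrix.mul_one, ρ.trace_eq_one, Complex.one_re]

/-- With `E k = Fᴴ * F` and `ρ₁ = Gᴴ * G`, the probability is the squared norm of `G * Fᴴ`. If it
vanishes, the columns of `Fᴴ` lie in the kernel of `ρ₁`, hence in that of `ρ₀`. -/
theorem POVM.prob_eq_zero (E : POVM d n) {ρ₀ ρ₁ : DensityMatrix d}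
    (hker : ∀ v : d → ℂ, ρ₁.mat.mulVec v = 0 → ρ₀.mat.mulVec v = 0) {k : Fin n}
    (h : E.prob ρ₁ k = 0) : E.prob ρ₀ k = 0 := by
  obtain ⟨F, hF⟩ := (E.posSemidef k).exists_eq_conjTranspose_mul_self
  obtain ⟨G, hG⟩ := ρ₁.posSemidef.exists_eq_conjTranspose_mul_self
  have h0 : (ρ₁.mat * E.effect k).trace = 0 :=
    Complex.ext h (Complex.nonneg_iff.1 (ρ₁.posSemidef.trace_mul_nonneg (E.posSemidef k))).2.symm
  have h1 : ((G * Fᴴ)ᴴ * (G * Fᴴ)).trace = 0 := by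
    rw [← h0, hF, hG, conjTranspose_mul, conjTranspose_conjTranspose,
      ← Matrix.mul_assoc _ Fᴴ F, Matrix.trace_mul_comm _ F]
    simp only [Matrix.mul_assoc]
  have h2 : G * Fᴴ = 0 := trace_conjTranspose_mul_self_eq_zero_iff.1 h1
  have h3 : ρ₁.mat * Fᴴ = 0 := by rw [hG, Matrix.mul_assoc, h2, Matrix.mul_zero]
  have h4 : ρ₀.mat * Fᴴ = 0 := by
    ext i j
    have := hker (Fᴴ.col j) (by
      ext i
      exact congrFun (congrFun h3 i) j)
    exact congrFun this i
  rw [POVM.prob, hF, ← Matrix.mul_assoc, h4, Matrix.zero_mul, trace_zero, Complex.zero_re]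

/-- The observable that takes the value `c k` at the outcome `k`. -/
noncomputable def POVM.observable (E : POVM d n) (c : Fin n → ℝ) : Matrix d d ℂ :=
  ∑ k, (c k : ℂ) • E.effect k

theorem POVM.isHermitian_observable (E : POVM d n) (c : Fin n → ℝ) :
    (E.observable c).IsHermitian := by
  simp only [IsHermitian, POVM.observable, conjTranspose_sum, conjTranspose_smul,
    (E.posSemidef _).isHermitian.eq, Complex.star_def, Complex.conj_ofReal]

theorem POVM.trace_mul_observable (E : POVM d n) (ρ : DensityMatrix d) (c : Fin n → ℝ) :
    (ρ.mat * E.observable c).trace.re = ∑ k, c k * E.prob ρ k := by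
  simp [POVM.observable, Matrix.mul_sum, trace_sum, POVM.prob]

/-- An operator variance is nonnegative: `∑ k, (c k - X) * E k * (c k - X)` is positive semidefinite
and equals `∑ k, c k ^ 2 • E k - X ^ 2`. -/
theorem POVM.trace_mul_observable_sq_le (E : POVM d n) (ρ : DensityMatrix d) (c : Fin n → ℝ) :
    (ρ.mat * (E.observable c * E.observable c)).trace.re ≤ ∑ k, c k ^ 2 * E.prob ρ k := by
  set X := E.observable c with hX
  have key : ∑ k, ((c k : ℂ) • 1 - X) * E.effect k * ((c k : ℂ) • 1 - X)ᴴ =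
      E.observable (fun k => c k ^ 2) - X * X := by
    have h (k : Fin n) : ((c k : ℂ) • 1 - X) * E.effect k * ((c k : ℂ) • 1 - X)ᴴ =
        ((c k ^ 2 : ℝ) : ℂ) • E.effect k - X * ((c k : ℂ) • E.effect k)
          - ((c k : ℂ) • E.effect k) * X + X * E.effect k * X := by
      rw [conjTranspose_sub, hX, (E.isHermitian_observable c).eq, ← hX, conjTranspose_smul,
        conjTranspose_one, Complex.star_def, Complex.conj_ofReal]
      simp only [sub_mul, mul_sub, smul_mul_assoc, mul_smul_comm, one_mul, mul_one, smul_sub,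
        smul_smul, Complex.ofReal_mul, pow_two]
      abel
    simp only [h, Finset.sum_add_distrib, Finset.sum_sub_distrib, ← Finset.mul_sum,
      ← Finset.sum_mul, E.sum_eq_one, mul_one]
    change E.observable (fun k => c k ^ 2) - X * X - X * X + X * X = _
    abel
  have hp : (E.observable (fun k => c k ^ 2) - X * X).PosSemidef := by
    rw [← key]
    exact posSemidef_sum _ fun k _ => (E.posSemidef k).mul_mul_conjTranspose_same _
  have h := (Complex.nonneg_iff.1 (ρ.posSemidef.trace_mul_nonneg hp)).1
  rw [mul_sub, trace_sub, Complex.sub_re, E.trace_mul_observable] at h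
  linarith

end Measurement

/-! ### Relative entropy as an integral of chi-squares -/

section EntropyPath

/-- The relative entropy density `a * log (a / b) - a + b` is the increment over `[0, 1]` of this
function, whose derivative is a chi-square density for the mixture `t * a + (1 - t) * b`. -/
noncomputable def entropyPath (a b t : ℝ) : ℝ :=
  a * Real.log (t * a + (1 - t) * b) - (t * a + (1 - t) * b)

theorem entropyPath_one_sub_zero (a b : ℝ) :
    entropyPath a b 1 - entropyPath a b 0 = a * Real.log a - a * Real.log b - a + b := by
  simp only [entropyPath]
  norm_num
  ring

theorem mixture_eq_zero {a b t : ℝ} (ha : 0 ≤ a) (hb : 0 ≤ b) (ht : t ∈ Set.Ioo (0 : ℝ) 1)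
    (h : t * a + (1 - t) * b = 0) : a = 0 ∧ b = 0 := by
  have h0 : 0 < 1 - t := sub_pos.2 ht.2
  have h1 := mul_nonneg ht.1.le ha
  have h2 := mul_nonneg h0.le hb
  exact ⟨(mul_eq_zero.1 (by linarith : t * a = 0)).resolve_left ht.1.ne',
    (mul_eq_zero.1 (by linarith : (1 - t) * b = 0)).resolve_left h0.ne'⟩

theorem hasDerivAt_entropyPath {a b t : ℝ} (ha : 0 ≤ a) (hb : 0 ≤ b)
    (ht : t ∈ Set.Ioo (0 : ℝ) 1) :
    HasDerivAt (entropyPath a b) ((1 - t) * ((a - b) ^ 2 / (t * a + (1 - t) * b))) t := by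
  by_cases h : t * a + (1 - t) * b = 0
  · obtain ⟨rfl, rfl⟩ := mixture_eq_zero ha hb ht h
    have : entropyPath 0 0 = fun _ => 0 := by
      ext s
      simp [entropyPath]
    simpa [this] using hasDerivAt_const t (0 : ℝ)
  · have h1 : HasDerivAt (fun s : ℝ => s * a + (1 - s) * b) (a - b) t := by
      have := ((hasDerivAt_id t).mul_const a).add (((hasDerivAt_id t).const_sub 1).mul_const b)
      refine this.congr_deriv ?_
      ring
    refine (((h1.log h).const_mul a).sub h1).congr_deriv ?_
    have h2 : (1 - t) * (a - b) = a - (t * a + (1 - t) * b) := by ring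
    have h3 : (1 - t) * ((a - b) ^ 2 / (t * a + (1 - t) * b)) =
        (a - b) * ((1 - t) * (a - b)) / (t * a + (1 - t) * b) := by ring
    rw [h3, h2]
    generalize t * a + (1 - t) * b = r at h ⊢
    field_simp

/-- Only the endpoints are delicate. The logarithm carries the factor `w * a`; if this is nonzero,
then `a` and `b` are both positive and the mixture stays away from `0`. -/
theorem continuousOn_mul_entropyPath {w a b : ℝ} (ha : 0 ≤ a) (hb : 0 ≤ b)
    (h : b = 0 → w * a = 0) :
    ContinuousOn (fun t => w * entropyPath a b t) (Set.Icc 0 1) := by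
  have e : (fun t => w * entropyPath a b t) = fun t =>
      w * a * Real.log (t * a + (1 - t) * b) - w * (t * a + (1 - t) * b) := by
    ext t
    simp only [entropyPath]
    ring
  rw [e]
  refine ContinuousOn.sub ?_ (by fun_prop)
  by_cases hw : w * a = 0
  · simpa only [hw, zero_mul] using continuousOn_const
  · have hb' : 0 < b := lt_of_le_of_ne hb fun h' => hw (h h'.symm)
    have ha' : 0 < a := lt_of_le_of_ne ha fun h' => hw (by rw [← h', mul_zero])
    refine continuousOn_const.mul (ContinuousOn.log (by fun_prop) fun t ht => ne_of_gt ?_)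
    nlinarith [mul_nonneg ht.1 ha, mul_nonneg (sub_nonneg.2 ht.2) hb, ht.1, ht.2,
      mul_pos ha' hb', le_total t (1 / 2)]

/-- The completed square behind the variational formula for chi-square, one matrix entry at a time.
-/
theorem mixture_mul_norm_sub_sq {a b t : ℝ} (ha : 0 ≤ a) (hb : 0 ≤ b)
    (ht : t ∈ Set.Ioo (0 : ℝ) 1) (c x : ℂ) :
    (t * a + (1 - t) * b) * ‖x - ((a - b) / (t * a + (1 - t) * b) : ℝ) * c‖ ^ 2 =
      ‖c‖ ^ 2 * ((a - b) ^ 2 / (t * a + (1 - t) * b)) - 2 * ((a - b) * (c * star x).re)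
        + (t * a + (1 - t) * b) * ‖x‖ ^ 2 := by
  by_cases h : t * a + (1 - t) * b = 0
  · obtain ⟨rfl, rfl⟩ := mixture_eq_zero ha hb ht h
    simp
  · simp only [Complex.sq_norm, Complex.normSq_apply, Complex.sub_re, Complex.sub_im,
      Complex.im_ofReal_mul, Complex.mul_re, Complex.star_def, Complex.ofReal_re,
      Complex.ofReal_im, Complex.conj_re, Complex.conj_im]
    generalize t * a + (1 - t) * b = r at h ⊢
    field_simp
    ring

end EntropyPath

/-! ### The chi-square inequality and its remainder -/

section Gap

variable {d : Type*} [Fintype d] [DecidableEq d] {n : ℕ}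

/-- The deviation of an observable `X` from the solution `Y` of
`t * A * Y + (1 - t) * Y * B = A - B`, where `A` and `B` have the eigenvalues `a`, `b` and the
eigenbases `U`, `V`. -/
noncomputable def deviation (U V : Matrix d d ℂ) (a b : d → ℝ) (t : ℝ) (X : Matrix d d ℂ) : ℝ :=
  ∑ i, ∑ j, (t * a i + (1 - t) * b j) * ‖(Uᴴ * X * V) i j -
    ((a i - b j) / (t * a i + (1 - t) * b j) : ℝ) * (Uᴴ * V) i j‖ ^ 2

theorem deviation_nonneg {d : Type*} [Fintype d] {U V : Matrix d d ℂ} {a b : d → ℝ} (ha : ∀ i, 0 ≤ a i)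
    (hb : ∀ j, 0 ≤ b j) {t : ℝ} (ht : t ∈ Set.Ioo (0 : ℝ) 1) (X : Matrix d d ℂ) :
    0 ≤ deviation U V a b t X :=
  Finset.sum_nonneg fun i _ => Finset.sum_nonneg fun j _ => mul_nonneg
    (add_nonneg (mul_nonneg ht.1.le (ha i)) (mul_nonneg (sub_nonneg.2 ht.2.le) (hb j)))
    (by positivity)

theorem deviation_eq {U V A B X : Matrix d d ℂ} {a b : d → ℝ} (hU : U * Uᴴ = 1)
    (hV : V * Vᴴ = 1) (hA : A = U * diagonal (fun i => (a i : ℂ)) * Uᴴ)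
    (hB : B = V * diagonal (fun i => (b i : ℂ)) * Vᴴ) (ha : ∀ i, 0 ≤ a i) (hb : ∀ j, 0 ≤ b j)
    {t : ℝ} (ht : t ∈ Set.Ioo (0 : ℝ) 1) (hX : X.IsHermitian) :
    deviation U V a b t X =
      ∑ i, ∑ j, ‖(Uᴴ * V) i j‖ ^ 2 * ((a i - b j) ^ 2 / (t * a i + (1 - t) * b j))
        - 2 * ((A * X).trace.re - (B * X).trace.re)
        + (t * (A * (X * X)).trace.re + (1 - t) * (B * (X * X)).trace.re) := by
  have e : (diagonal (fun _ => 1) : Matrix d d ℂ) = 1 := diagonal_one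
  have h3 (z : ℂ) : z * star z = ((‖z‖ ^ 2 : ℝ) : ℂ) := by
    simpa using Complex.mul_conj' z
  have hAX := trace_diagonalized_mul_mul U V 1 X (fun i => (a i : ℂ)) (fun _ => 1)
  have hBX := trace_diagonalized_mul_mul U V 1 X (fun _ => 1) (fun i => (b i : ℂ))
  have hAXX := trace_diagonalized_mul_mul U V X X (fun i => (a i : ℂ)) (fun _ => 1)
  have hBXX := trace_diagonalized_mul_mul U V X X (fun _ => 1) (fun i => (b i : ℂ))
  simp only [← hA, ← hB, e, hU, hV, hX.eq, h3, one_mul, mul_one]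
    at hAX hBX hAXX hBXX
  rw [Matrix.mul_assoc] at hAXX
  -- The weights `b j` act on the right index, so the trace arises as `X * B * X` and is rotated.
  rw [Matrix.trace_mul_comm, ← Matrix.mul_assoc, Matrix.trace_mul_comm] at hBXX
  simp only [hAX, hBX, hAXX, hBXX, Complex.re_sum, deviation, Complex.re_ofReal_mul,
    Complex.ofReal_re, mixture_mul_norm_sub_sq (ha _) (hb _) ht, Finset.mul_sum,
    ← Finset.sum_sub_distrib, ← Finset.sum_add_distrib]
  refine Finset.sum_congr rfl fun i _ => Finset.sum_congr rfl fun j _ => ?_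
  ring

/-- The chi-square information of the outcomes of a measurement is at most its quantum
counterpart, with a remainder. -/
theorem POVM.exists_chiSquare_add_deviation_le (E : POVM d n) {ρ₀ ρ₁ : DensityMatrix d}
    {U V : Matrix d d ℂ} {a b : d → ℝ} (hU : U * Uᴴ = 1)
    (hV : V * Vᴴ = 1) (hA : ρ₀.mat = U * diagonal (fun i => (a i : ℂ)) * Uᴴ)
    (hB : ρ₁.mat = V * diagonal (fun i => (b i : ℂ)) * Vᴴ) (ha : ∀ i, 0 ≤ a i)
    (hb : ∀ j, 0 ≤ b j) {t : ℝ} (ht : t ∈ Set.Ioo (0 : ℝ) 1) :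
    ∃ X : Matrix d d ℂ, X.IsHermitian ∧
      ∑ k, (E.prob ρ₀ k - E.prob ρ₁ k) ^ 2 / (t * E.prob ρ₀ k + (1 - t) * E.prob ρ₁ k)
        + deviation U V a b t X ≤
      ∑ i, ∑ j, ‖(Uᴴ * V) i j‖ ^ 2 * ((a i - b j) ^ 2 / (t * a i + (1 - t) * b j)) := by
  -- The maximizer of `2 * c * (p - q) - c ^ 2 * r`, with `r = t * p + (1 - t) * q`; the maximum is
  -- the classical chi-square term `(p - q) ^ 2 / r`.
  set c : Fin n → ℝ := fun k =>
    (E.prob ρ₀ k - E.prob ρ₁ k) / (t * E.prob ρ₀ k + (1 - t) * E.prob ρ₁ k) with hc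
  have hX := E.isHermitian_observable c
  refine ⟨E.observable c, hX, ?_⟩
  rw [deviation_eq hU hV hA hB ha hb ht hX, E.trace_mul_observable, E.trace_mul_observable]
  have h0 := mul_le_mul_of_nonneg_left (E.trace_mul_observable_sq_le ρ₀ c) ht.1.le
  have h1 := mul_le_mul_of_nonneg_left (E.trace_mul_observable_sq_le ρ₁ c) (sub_nonneg.2 ht.2.le)
  have key : ∑ k, (E.prob ρ₀ k - E.prob ρ₁ k) ^ 2 / (t * E.prob ρ₀ k + (1 - t) * E.prob ρ₁ k) =
      2 * (∑ k, c k * E.prob ρ₀ k - ∑ k, c k * E.prob ρ₁ k) -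
        (t * ∑ k, c k ^ 2 * E.prob ρ₀ k + (1 - t) * ∑ k, c k ^ 2 * E.prob ρ₁ k) := by
    simp only [Finset.mul_sum, ← Finset.sum_sub_distrib, ← Finset.sum_add_distrib]
    refine Finset.sum_congr rfl fun k _ => ?_
    simp only [hc]
    by_cases h : t * E.prob ρ₀ k + (1 - t) * E.prob ρ₁ k = 0
    · simp [h]
    · have e : ∀ p q r : ℝ, r = t * p + (1 - t) * q → r ≠ 0 → (p - q) ^ 2 / r =
          2 * ((p - q) / r * p - (p - q) / r * q) -
            (t * (((p - q) / r) ^ 2 * p) + (1 - t) * (((p - q) / r) ^ 2 * q)) := by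
        intro p q r hr hr0
        have : t * (((p - q) / r) ^ 2 * p) + (1 - t) * (((p - q) / r) ^ 2 * q) =
          ((p - q) / r) ^ 2 * r := by rw [hr]; ring
        rw [this]
        field_simp
        ring
      exact e _ _ _ rfl h
  linarith

/-- A regularization of `A - B` that appears in the lower bound for the deviation. -/
noncomputable def regularizedDifference (U V : Matrix d d ℂ) (a b : d → ℝ) (t : ℝ) :
    Matrix d d ℂ :=
  U * of (fun i j => ((b j * (a i - b j) / (t * a i + (1 - t) * b j) : ℝ) : ℂ) * (Uᴴ * V) i j) * Vᴴ

/-- Here `M = Y * B`, with `Y` the matrix from which `deviation` measures. Multiplying `X - Y` by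
`B` replaces the weight `t * a + (1 - t) * b` by `b ^ 2`, which is at most twice as large because `b
≤ 1` and `t ≤ 1 / 2`. -/
theorem hilbertSchmidtSq_regularizedDifference_le {U V B X : Matrix d d ℂ} {a b : d → ℝ}
    (hU : U * Uᴴ = 1) (hU' : Uᴴ * U = 1) (hV : V * Vᴴ = 1) (hV' : Vᴴ * V = 1)
    (hB : B = V * diagonal (fun i => (b i : ℂ)) * Vᴴ) (ha : ∀ i, 0 ≤ a i) (hb : ∀ j, 0 ≤ b j)
    (hb1 : ∀ j, b j ≤ 1) {t : ℝ} (ht0 : 0 < t) (ht : t ≤ 1 / 2) (hX : X.IsHermitian)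
    (hBH : B.IsHermitian) :
    (B * regularizedDifference U V a b t - (regularizedDifference U V a b t)ᴴ * B).hilbertSchmidtSq
      ≤ 8 * B.hilbertSchmidtSq * deviation U V a b t X := by
  set M := regularizedDifference U V a b t with hM
  refine (hX.hilbertSchmidtSq_sub_conjTranspose_le hBH M).trans ?_
  suffices h : (X * B - M).hilbertSchmidtSq ≤ 2 * deviation U V a b t X by
    nlinarith [mul_le_mul_of_nonneg_left h B.hilbertSchmidtSq_nonneg]
  rw [← hilbertSchmidtSq_conj hU hV]
  have e1 : Uᴴ * (X * B - M) * V = (Uᴴ * X * V) * diagonal (fun i => (b i : ℂ)) -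
      of (fun i j =>
        ((b j * (a i - b j) / (t * a i + (1 - t) * b j) : ℝ) : ℂ) * (Uᴴ * V) i j) := by
    rw [hM, regularizedDifference, hB, Matrix.mul_sub, Matrix.sub_mul]
    congr 1
    · simp only [Matrix.mul_assoc, hV', Matrix.mul_one]
    · simp only [Matrix.mul_assoc, hV', Matrix.mul_one]
      rw [← Matrix.mul_assoc, hU', Matrix.one_mul]
  rw [e1, hilbertSchmidtSq, deviation, Finset.mul_sum]
  refine Finset.sum_le_sum fun i _ => ?_
  rw [Finset.mul_sum]
  refine Finset.sum_le_sum fun j _ => ?_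
  have e2 : ((Uᴴ * X * V) * diagonal (fun i => (b i : ℂ)) - of (fun i j =>
      ((b j * (a i - b j) / (t * a i + (1 - t) * b j) : ℝ) : ℂ) * (Uᴴ * V) i j)) i j =
      (b j : ℂ) * ((Uᴴ * X * V) i j -
        ((a i - b j) / (t * a i + (1 - t) * b j) : ℝ) * (Uᴴ * V) i j) := by
    rw [Matrix.sub_apply, mul_diagonal, of_apply, mul_div_assoc, Complex.ofReal_mul]
    ring
  rw [e2, norm_mul, mul_pow, ← mul_assoc, Complex.norm_real, Real.norm_of_nonneg (hb j)]
  refine mul_le_mul_of_nonneg_right ?_ (by positivity)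
  nlinarith [mul_nonneg ht0.le (ha i), hb j, hb1 j, mul_nonneg (hb j) (sub_nonneg.2 (hb1 j)),
    mul_nonneg (hb j) (sub_nonneg.2 ht)]

theorem continuousAt_regularizedDifference {d : Type*} [Fintype d] (U V : Matrix d d ℂ)
    (a b : d → ℝ) :
    ContinuousAt (regularizedDifference U V a b) 0 := by
  have h : ContinuousAt (fun t : ℝ => (of (fun i j =>
      ((b j * (a i - b j) / (t * a i + (1 - t) * b j) : ℝ) : ℂ) * (Uᴴ * V) i j) :
        Matrix d d ℂ)) 0 := by
    refine continuousAt_pi.2 fun i => continuousAt_pi.2 fun j => ?_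
    refine ContinuousAt.mul ?_ continuousAt_const
    refine Complex.continuous_ofReal.continuousAt.comp ?_
    -- If `b j = 0` the entry vanishes for every `t`; otherwise the denominator tends to `b j ≠ 0`.
    -- The factor `b j` is what makes the limit exist.
    by_cases hj : b j = 0
    · simpa only [hj, zero_mul, zero_div] using continuousAt_const
    · exact ContinuousAt.div continuousAt_const (by fun_prop) (by simpa using hj)
  have h2 : Continuous fun Z : Matrix d d ℂ => U * Z * Vᴴ := by fun_prop
  exact ContinuousAt.comp (f := fun t : ℝ => (of (fun i j =>
      ((b j * (a i - b j) / (t * a i + (1 - t) * b j) : ℝ) : ℂ) * (Uᴴ * V) i j) :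
        Matrix d d ℂ)) h2.continuousAt h

theorem regularizedDifference_zero {U V A B : Matrix d d ℂ} {a b : d → ℝ} (hU : U * Uᴴ = 1)
    (hV : V * Vᴴ = 1) (hA : A = U * diagonal (fun i => (a i : ℂ)) * Uᴴ)
    (hB : B = V * diagonal (fun i => (b i : ℂ)) * Vᴴ)
    (hab : ∀ i j, b j = 0 → ‖(Uᴴ * V) i j‖ ^ 2 * a i = 0) :
    regularizedDifference U V a b 0 = A - B := by
  have h : (of (fun i j =>
      ((b j * (a i - b j) / (0 * a i + (1 - 0) * b j) : ℝ) : ℂ) * (Uᴴ * V) i j) :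
        Matrix d d ℂ) = diagonal (fun i => (a i : ℂ)) * (Uᴴ * V) -
        (Uᴴ * V) * diagonal (fun i => (b i : ℂ)) := by
    ext i j
    rw [of_apply, Matrix.sub_apply, diagonal_mul, mul_diagonal, zero_mul, zero_add, sub_zero,
      one_mul]
    -- The quotient `0 / 0` is `0` by convention; the matching entry of `A - B` also vanishes, by
    -- the kernel condition `hab`.
    by_cases hj : b j = 0
    · have h := hab i j hj
      rcases mul_eq_zero.1 h with h | h
      · have : (Uᴴ * V) i j = 0 := by simpa using h
        simp [this]
      · simp [h, hj]
    · rw [mul_div_cancel_left₀ _ hj, Complex.ofReal_sub]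
      ring
  rw [regularizedDifference, h, Matrix.mul_sub, Matrix.sub_mul, hA, hB]
  congr 1
  · simp only [Matrix.mul_assoc, hV, Matrix.mul_one]
  · simp only [← Matrix.mul_assoc, hU, Matrix.one_mul]

/-- At `t = 0` the anti-Hermitian defect of `B * M` is `B * A - A * B ≠ 0`. By continuity its
squared norm stays above half of that value for small `t`, and the previous bound turns this into
one on the deviation, the same for all `X`. -/
theorem exists_pos_le_deviation {U V A B : Matrix d d ℂ} {a b : d → ℝ}
    (hU : U * Uᴴ = 1) (hU' : Uᴴ * U = 1) (hV : V * Vᴴ = 1) (hV' : Vᴴ * V = 1)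
    (hA : A = U * diagonal (fun i => (a i : ℂ)) * Uᴴ)
    (hB : B = V * diagonal (fun i => (b i : ℂ)) * Vᴴ) (ha : ∀ i, 0 ≤ a i) (hb : ∀ j, 0 ≤ b j)
    (hb1 : ∀ j, b j ≤ 1) (hAH : A.IsHermitian) (hBH : B.IsHermitian)
    (hab : ∀ i j, b j = 0 → ‖(Uᴴ * V) i j‖ ^ 2 * a i = 0) (hcomm : ¬ Commute A B) :
    ∃ g > 0, ∃ s ∈ Set.Ioc (0 : ℝ) (1 / 2), ∀ t ∈ Set.Ioo 0 s, ∀ X : Matrix d d ℂ,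
      X.IsHermitian → g ≤ deviation U V a b t X := by
  have hB0 : 0 < B.hilbertSchmidtSq := hilbertSchmidtSq_pos fun h => hcomm (by
    rw [h]
    exact Commute.zero_right A)
  set φ : ℝ → ℝ := fun t => (B * regularizedDifference U V a b t -
    (regularizedDifference U V a b t)ᴴ * B).hilbertSchmidtSq with hφ
  have hφ0 : 0 < φ 0 := by
    refine hilbertSchmidtSq_pos fun h => hcomm ?_
    rw [regularizedDifference_zero hU hV hA hB hab, conjTranspose_sub, hAH.eq, hBH.eq,
      mul_sub, sub_mul, sub_sub_sub_cancel_right, sub_eq_zero] at h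
    exact h.symm
  have hφc : ContinuousAt φ 0 := by
    have h2 : Continuous fun Z : Matrix d d ℂ => (B * Z - Zᴴ * B).hilbertSchmidtSq := by
      unfold hilbertSchmidtSq
      refine continuous_finsetSum _ fun i _ => continuous_finsetSum _ fun j _ => ?_
      have : Continuous fun Z : Matrix d d ℂ => B * Z - Zᴴ * B := by fun_prop
      exact ((this.matrix_elem i j).norm).pow 2
    exact ContinuousAt.comp (f := regularizedDifference U V a b) h2.continuousAt
      (continuousAt_regularizedDifference U V a b)
  obtain ⟨ε, hε, hball⟩ := Metric.eventually_nhds_iff.1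
    (hφc.eventually (lt_mem_nhds (half_lt_self hφ0)))
  refine ⟨φ 0 / 2 / (8 * B.hilbertSchmidtSq), by positivity, min ε (1 / 2),
    ⟨lt_min hε (by norm_num), min_le_right _ _⟩, fun t ht X hX => ?_⟩
  have h1 : φ 0 / 2 < φ t := hball (by
    rw [Real.dist_eq, sub_zero, abs_of_pos ht.1]
    exact ht.2.trans_le (min_le_left _ _))
  have h2 := hilbertSchmidtSq_regularizedDifference_le hU hU' hV hV' hB ha hb hb1 ht.1
    (ht.2.le.trans (min_le_right _ _)) hX hBH
  rw [div_le_iff₀ (by positivity)]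
  linarith

end Gap

/-! ### The loss of information in a measurement -/

section Umegaki

variable {d : Type*} [Fintype d] [DecidableEq d] {n : ℕ}

/-- Spectral decompositions of two density matrices, with the weights `‖(Uᴴ * V) i j‖ ^ 2`. -/
structure JointSpectralData (ρ₀ ρ₁ : DensityMatrix d) where
  /-- an eigenbasis of `ρ₀` -/
  U : Matrix d d ℂ
  /-- an eigenbasis of `ρ₁` -/
  V : Matrix d d ℂ
  /-- the eigenvalues of `ρ₀` -/
  a : d → ℝ
  /-- the eigenvalues of `ρ₁` -/
  b : d → ℝ
  U_mul : U * Uᴴ = 1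
  mul_U : Uᴴ * U = 1
  V_mul : V * Vᴴ = 1
  mul_V : Vᴴ * V = 1
  mat_zero : ρ₀.mat = U * diagonal (fun i => (a i : ℂ)) * Uᴴ
  mat_one : ρ₁.mat = V * diagonal (fun i => (b i : ℂ)) * Vᴴ
  a_nonneg : ∀ i, 0 ≤ a i
  b_nonneg : ∀ j, 0 ≤ b j
  b_le_one : ∀ j, b j ≤ 1
  weight_eq_zero : ∀ i j, b j = 0 → ‖(Uᴴ * V) i j‖ ^ 2 * a i = 0
  umegaki_eq : umegakiInformation ρ₀ ρ₁ = ∑ i, ∑ j, ‖(Uᴴ * V) i j‖ ^ 2 *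
    (entropyPath (a i) (b j) 1 - entropyPath (a i) (b j) 0)

theorem Matrix.PosSemidef.eigenvalues_nonneg_of_eq {A U : Matrix d d ℂ} {a : d → ℝ}
    (hA : A.PosSemidef) (hU : Uᴴ * U = 1)
    (h : A = U * diagonal (fun i => (a i : ℂ)) * Uᴴ) (i : d) : 0 ≤ a i := by
  have h1 : Uᴴ * A * U = diagonal (fun i => (a i : ℂ)) := by
    rw [h]
    simp only [Matrix.mul_assoc, hU, Matrix.mul_one]
    rw [← Matrix.mul_assoc, hU, Matrix.one_mul]
  have h2 := hA.conjTranspose_mul_mul_same U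
  rw [h1, posSemidef_diagonal_iff] at h2
  exact_mod_cast h2 i

theorem exists_jointSpectralData {ρ₀ ρ₁ : DensityMatrix d}
    (hker : ∀ v : d → ℂ, ρ₁.mat.mulVec v = 0 → ρ₀.mat.mulVec v = 0) :
    Nonempty (JointSpectralData ρ₀ ρ₁) := by
  obtain ⟨U, a, hU, hU', hA, hAf⟩ := ρ₀.posSemidef.isHermitian.exists_cfc_eq
  obtain ⟨V, b, hV, hV', hB, hBf⟩ := ρ₁.posSemidef.isHermitian.exists_cfc_eq
  have ha := ρ₀.posSemidef.eigenvalues_nonneg_of_eq hU' hA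
  have hb := ρ₁.posSemidef.eigenvalues_nonneg_of_eq hV' hB
  have hb1 : ∑ j, b j = 1 := by
    have h := ρ₁.trace_eq_one
    rw [hB, trace_mul_comm, ← Matrix.mul_assoc, hV', Matrix.one_mul, trace_diagonal] at h
    exact_mod_cast h
  refine ⟨⟨U, V, a, b, hU, hU', hV, hV', hA, hB, ha, hb, fun j => ?_, fun i j hj => ?_, ?_⟩⟩
  · rw [← hb1]
    exact Finset.single_le_sum (fun j _ => hb j) (Finset.mem_univ j)
  · have h1 : ρ₁.mat * V = V * diagonal (fun i => (b i : ℂ)) := by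
      rw [hB, Matrix.mul_assoc, hV', Matrix.mul_one]
    -- An eigenvector of `ρ₁` for the eigenvalue `0` is killed by `ρ₀` too, so its overlap with
    -- eigenvectors of `ρ₀` of nonzero eigenvalue is zero.
    have h2 : ρ₁.mat.mulVec (V.col j) = 0 := by
      ext k
      have : (ρ₁.mat * V) k j = 0 := by rw [h1, mul_diagonal, hj, Complex.ofReal_zero, mul_zero]
      exact this
    have h3 := hker _ h2
    have h4 : Uᴴ * (ρ₀.mat * V) = diagonal (fun i => (a i : ℂ)) * (Uᴴ * V) := by
      rw [hA]
      simp only [← Matrix.mul_assoc, hU', Matrix.one_mul]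
    have h5 : (Uᴴ * (ρ₀.mat * V)) i j = 0 := by
      rw [Matrix.mul_apply]
      refine Finset.sum_eq_zero fun k _ => ?_
      have : (ρ₀.mat * V) k j = 0 := congrFun h3 k
      rw [this, mul_zero]
    rw [h4, diagonal_mul] at h5
    rcases mul_eq_zero.1 h5 with h | h
    · rw [Complex.ofReal_eq_zero.1 h, mul_zero]
    · rw [h, norm_zero, zero_pow two_ne_zero, zero_mul]
  · have e : (diagonal (fun _ => 1) : Matrix d d ℂ) = 1 := diagonal_one
    have h3 (z : ℂ) : z * star z = ((‖z‖ ^ 2 : ℝ) : ℂ) := by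
      simpa using Complex.mul_conj' z
    have h1 := trace_diagonalized_mul_mul U V 1 1
      (fun i => ((a i * Real.log (a i) : ℝ) : ℂ)) (fun _ => 1)
    have h2 := trace_diagonalized_mul_mul U V 1 1 (fun i => (a i : ℂ))
      (fun j => (Real.log (b j) : ℂ))
    have h4 := trace_diagonalized_mul_mul U V 1 1 (fun i => (a i : ℂ)) (fun _ => 1)
    have h5 := trace_diagonalized_mul_mul U V 1 1 (fun _ => 1) (fun j => (b j : ℂ))
    have hlog : ρ₀.mat * cfc Real.log ρ₀.mat =
        U * diagonal (fun i => ((a i * Real.log (a i) : ℝ) : ℂ)) * Uᴴ := by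
      rw [hAf, hA]
      simp only [Matrix.mul_assoc]
      rw [← Matrix.mul_assoc Uᴴ, hU', Matrix.one_mul, ← Matrix.mul_assoc (diagonal _),
        diagonal_mul_diagonal]
      simp only [Complex.ofReal_mul]
    simp only [← hA, ← hB, ← hBf, ← hlog, e, hU, hV,
      conjTranspose_one, h3, one_mul, mul_one, ρ₀.trace_eq_one, ρ₁.trace_eq_one] at h1 h2 h4 h5
    have h4' := congrArg Complex.re h4
    have h5' := congrArg Complex.re h5
    rw [umegakiInformation, trace_sub, Complex.sub_re, h1, h2]
    simp only [Complex.re_sum, ← Complex.ofReal_mul, Complex.ofReal_re, Complex.one_re]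
      at h4' h5' ⊢
    -- The linear corrections `-a i + b j` sum to `-tr ρ₀ + tr ρ₁ = 0`.
    have h6 : ∀ i j, ‖(Uᴴ * V) i j‖ ^ 2 * (entropyPath (a i) (b j) 1 - entropyPath (a i) (b j) 0) =
        a i * Real.log (a i) * ‖(Uᴴ * V) i j‖ ^ 2 - a i * Real.log (b j) * ‖(Uᴴ * V) i j‖ ^ 2
          - a i * ‖(Uᴴ * V) i j‖ ^ 2 + b j * ‖(Uᴴ * V) i j‖ ^ 2 := fun i j => by
      rw [entropyPath_one_sub_zero]
      ring
    simp only [h6, Finset.sum_sub_distrib, Finset.sum_add_distrib, ← h4', ← h5']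
    ring

theorem POVM.klInformation_eq (E : POVM d n) {ρ₀ ρ₁ : DensityMatrix d}
    (hker : ∀ v : d → ℂ, ρ₁.mat.mulVec v = 0 → ρ₀.mat.mulVec v = 0) :
    klInformation (E.prob ρ₀) (E.prob ρ₁) = ∑ k,
      (entropyPath (E.prob ρ₀ k) (E.prob ρ₁ k) 1 - entropyPath (E.prob ρ₀ k) (E.prob ρ₁ k) 0) := by
  have h : ∀ k, E.prob ρ₀ k * Real.log (E.prob ρ₀ k / E.prob ρ₁ k) =
      E.prob ρ₀ k * Real.log (E.prob ρ₀ k) - E.prob ρ₀ k * Real.log (E.prob ρ₁ k) := fun k => by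
    by_cases h0 : E.prob ρ₀ k = 0
    · simp [h0]
    · rw [Real.log_div h0 fun h1 => h0 (E.prob_eq_zero hker h1)]
      ring
  simp only [klInformation, h, entropyPath_one_sub_zero, Finset.sum_add_distrib,
    Finset.sum_sub_distrib, E.sum_prob]
  ring

/-- A lower bound for the deviation near `0` bounds the loss of information in a measurement. -/
theorem JointSpectralData.mul_le_umegakiInformation_sub {ρ₀ ρ₁ : DensityMatrix d}
    (S : JointSpectralData ρ₀ ρ₁)
    (hker : ∀ v : d → ℂ, ρ₁.mat.mulVec v = 0 → ρ₀.mat.mulVec v = 0) (E : POVM d n)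
    {g s : ℝ} (hg : 0 ≤ g) (hs0 : 0 ≤ s) (hs : s ≤ 1 / 2)
    (h : ∀ t ∈ Set.Ioo 0 s, ∀ X : Matrix d d ℂ, X.IsHermitian →
      g ≤ deviation S.U S.V S.a S.b t X) :
    g / 2 * s ≤ umegakiInformation ρ₀ ρ₁ - klInformation (E.prob ρ₀) (E.prob ρ₁) := by
  -- The derivative of `Ψ` is `1 - t` times the quantum minus the classical chi-square, hence at
  -- least `1 - t` times a deviation.
  set Ψ : ℝ → ℝ := fun t => (∑ i, ∑ j, ‖(S.Uᴴ * S.V) i j‖ ^ 2 * entropyPath (S.a i) (S.b j) t) -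
    ∑ k, entropyPath (E.prob ρ₀ k) (E.prob ρ₁ k) t with hΨ
  have hend : umegakiInformation ρ₀ ρ₁ - klInformation (E.prob ρ₀) (E.prob ρ₁) = Ψ 1 - Ψ 0 := by
    rw [S.umegaki_eq, E.klInformation_eq hker]
    simp only [hΨ, mul_sub, Finset.sum_sub_distrib]
    ring
  have hcont : ContinuousOn Ψ (Set.Icc 0 1) := by
    refine ContinuousOn.sub (continuousOn_finsetSum _ fun i _ => continuousOn_finsetSum _
      fun j _ => continuousOn_mul_entropyPath (S.a_nonneg i) (S.b_nonneg j)
        (S.weight_eq_zero i j)) (continuousOn_finsetSum _ fun k _ => ?_)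
    have := continuousOn_mul_entropyPath (w := 1) (E.prob_nonneg ρ₀ k) (E.prob_nonneg ρ₁ k)
      fun h => by rw [E.prob_eq_zero hker h, mul_zero]
    simpa only [one_mul] using this
  have hderiv : ∀ t ∈ Set.Ioo (0 : ℝ) 1, HasDerivAt Ψ ((1 - t) *
      ((∑ i, ∑ j, ‖(S.Uᴴ * S.V) i j‖ ^ 2 *
        ((S.a i - S.b j) ^ 2 / (t * S.a i + (1 - t) * S.b j))) -
      ∑ k, (E.prob ρ₀ k - E.prob ρ₁ k) ^ 2 /
        (t * E.prob ρ₀ k + (1 - t) * E.prob ρ₁ k))) t := by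
    intro t ht
    have h1 := HasDerivAt.fun_sum (u := Finset.univ) fun i _ =>
      HasDerivAt.fun_sum (u := Finset.univ) fun j _ =>
        (hasDerivAt_entropyPath (S.a_nonneg i) (S.b_nonneg j) ht).const_mul
          (‖(S.Uᴴ * S.V) i j‖ ^ 2)
    have h2 := HasDerivAt.fun_sum (u := Finset.univ) fun k _ =>
      hasDerivAt_entropyPath (E.prob_nonneg ρ₀ k) (E.prob_nonneg ρ₁ k) ht
    refine (h1.sub h2).congr_deriv ?_
    simp only [mul_sub, Finset.mul_sum]
    congr 1
    refine Finset.sum_congr rfl fun i _ => Finset.sum_congr rfl fun j _ => ?_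
    ring
  have hbound : ∀ t ∈ Set.Ioo (0 : ℝ) 1, ∃ X : Matrix d d ℂ, X.IsHermitian ∧
      (1 - t) * deviation S.U S.V S.a S.b t X ≤ deriv Ψ t := fun t ht => by
    obtain ⟨X, hX, hle⟩ := E.exists_chiSquare_add_deviation_le S.U_mul S.V_mul S.mat_zero
      S.mat_one S.a_nonneg S.b_nonneg ht
    refine ⟨X, hX, ?_⟩
    rw [(hderiv t ht).deriv]
    exact mul_le_mul_of_nonneg_left (by linarith) (sub_nonneg.2 ht.2.le)
  have hmono : MonotoneOn Ψ (Set.Icc 0 1) := by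
    refine monotoneOn_of_deriv_nonneg (convex_Icc 0 1) hcont ?_ ?_ <;> rw [interior_Icc]
    · exact fun t ht => (hderiv t ht).differentiableAt.differentiableWithinAt
    · intro t ht
      obtain ⟨X, -, hle⟩ := hbound t ht
      exact (mul_nonneg (sub_nonneg.2 ht.2.le)
        (deviation_nonneg S.a_nonneg S.b_nonneg ht X)).trans hle
  -- On `(0, s)` the factor `1 - t` is at least `1 / 2`; past `s`, monotonicity is enough.
  have hstep : g / 2 * (s - 0) ≤ Ψ s - Ψ 0 := by
    refine Convex.mul_sub_le_image_sub_of_le_deriv (convex_Icc 0 s)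
      (hcont.mono (Set.Icc_subset_Icc_right (by linarith))) ?_ ?_ 0 ⟨le_rfl, hs0⟩ s
      ⟨hs0, le_rfl⟩ hs0 <;> rw [interior_Icc] <;> intro t ht <;>
      have ht1 : t ∈ Set.Ioo (0 : ℝ) 1 := ⟨ht.1, by linarith [ht.2]⟩
    · exact (hderiv t ht1).differentiableAt.differentiableWithinAt
    · obtain ⟨X, hX, hle⟩ := hbound t ht1
      refine le_trans ?_ hle
      nlinarith [h t ht X hX, ht.2]
  have hlast := hmono ⟨hs0, by linarith⟩ ⟨zero_le_one, le_rfl⟩ (by linarith : s ≤ 1)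
  rw [hend]
  linarith

theorem klInformation_le_umegakiInformation {ρ₀ ρ₁ : DensityMatrix d}
    (hker : ∀ v : d → ℂ, ρ₁.mat.mulVec v = 0 → ρ₀.mat.mulVec v = 0) (E : POVM d n) :
    klInformation (E.prob ρ₀) (E.prob ρ₁) ≤ umegakiInformation ρ₀ ρ₁ := by
  obtain ⟨S⟩ := exists_jointSpectralData hker
  -- With `g = s = 0` the interval is empty and only monotonicity of `Ψ` is used.
  have := S.mul_le_umegakiInformation_sub hker E le_rfl le_rfl (by norm_num)
    fun t ht => (lt_asymm ht.1 ht.2).elim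
  linarith

theorem exists_pos_klInformation_add_le {ρ₀ ρ₁ : DensityMatrix d}
    (hker : ∀ v : d → ℂ, ρ₁.mat.mulVec v = 0 → ρ₀.mat.mulVec v = 0)
    (hcomm : ¬ Commute ρ₀.mat ρ₁.mat) :
    ∃ ε > 0, ∀ (n : ℕ) (E : POVM d n),
      klInformation (E.prob ρ₀) (E.prob ρ₁) + ε ≤ umegakiInformation ρ₀ ρ₁ := by
  obtain ⟨S⟩ := exists_jointSpectralData hker
  obtain ⟨g, hg, s, hs, h⟩ := exists_pos_le_deviation S.U_mul S.mul_U S.V_mul S.mul_V S.mat_zero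
    S.mat_one S.a_nonneg S.b_nonneg S.b_le_one ρ₀.posSemidef.isHermitian
    ρ₁.posSemidef.isHermitian S.weight_eq_zero hcomm
  refine ⟨g / 2 * s, mul_pos (half_pos hg) hs.1, fun n E => ?_⟩
  have := S.mul_le_umegakiInformation_sub hker E hg.le hs.1.le hs.2 h
  linarith

end Umegaki

/-! ### Commuting states: joint spectral measurement -/

section Commuting

variable {d : Type*} [Fintype d] [DecidableEq d] {n : ℕ}

/-- The spectral projection of a Hermitian matrix at a real number. -/
noncomputable def Matrix.spectralProjection (A : Matrix d d ℂ) (x : ℝ) : Matrix d d ℂ :=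
  cfc (fun y => if y = x then (1 : ℝ) else 0) A

theorem Matrix.cfc_mul_spectralProjection {A : Matrix d d ℂ} (f : ℝ → ℝ) (x : ℝ) :
    cfc f A * A.spectralProjection x = f x • A.spectralProjection x := by
  have hc (g : ℝ → ℝ) : ContinuousOn g (spectrum ℝ A) :=
    (finite_real_spectrum (A := A)).continuousOn g
  rw [spectralProjection, ← cfc_mul _ _ _ (hc _) (hc _), ← cfc_const_mul _ _ _ (hc _)]
  congr 1
  ext y
  split_ifs with h <;> simp [h]

theorem Matrix.spectralProjection_mul_self (A : Matrix d d ℂ) (x : ℝ) :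
    A.spectralProjection x * A.spectralProjection x = A.spectralProjection x := by
  have h := cfc_mul_spectralProjection (A := A) (fun y => if y = x then (1 : ℝ) else 0) x
  rwa [if_pos rfl, one_smul] at h

theorem Matrix.isHermitian_spectralProjection (A : Matrix d d ℂ) (x : ℝ) :
    (A.spectralProjection x).IsHermitian :=
  cfc_predicate (p := IsSelfAdjoint) (fun y => if y = x then (1 : ℝ) else 0) A

theorem Matrix.IsHermitian.sum_spectralProjection {A : Matrix d d ℂ} (hA : A.IsHermitian) :
    ∑ x ∈ (finite_real_spectrum (A := A)).toFinset, A.spectralProjection x = 1 := by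
  have hA' : IsSelfAdjoint A := hA
  have hc (g : ℝ → ℝ) : ContinuousOn g (spectrum ℝ A) :=
    (finite_real_spectrum (A := A)).continuousOn g
  simp only [spectralProjection]
  rw [← cfc_sum _ _ _ fun x _ => hc _, ← cfc_one ℝ A]
  refine cfc_congr fun y hy => ?_
  rw [Finset.sum_apply, Finset.sum_ite_eq, if_pos (by simpa using hy), Pi.one_apply]

theorem Commute.spectralProjection {A B : Matrix d d ℂ} (h : Commute A B) (x y : ℝ) :
    Commute (A.spectralProjection x) (B.spectralProjection y) :=
  ((h.cfc_real _).symm.cfc_real _).symm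

theorem POVM.exists_of_fintype {ι : Type*} [Fintype ι] (F : ι → Matrix d d ℂ)
    (hF : ∀ k, (F k).PosSemidef) (hsum : ∑ k, F k = 1) :
    ∃ (n : ℕ) (e : Fin n ≃ ι) (E : POVM d n), ∀ k, E.effect k = F (e k) :=
  ⟨Fintype.card ι, (Fintype.equivFin ι).symm, ⟨fun k => F ((Fintype.equivFin ι).symm k),
    fun _ => hF _, by rw [Equiv.sum_comp (Fintype.equivFin ι).symm F, hsum]⟩, fun _ => rfl⟩

/-- The products `P x * Q y` of spectral projections form a POVM because they commute. On such an
effect the states act as the scalars `x` and `y`, so its trace cancels in the likelihood ratio,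
leaving `log (x / y)`. -/
theorem exists_klInformation_eq_of_commute {ρ₀ ρ₁ : DensityMatrix d}
    (hker : ∀ v : d → ℂ, ρ₁.mat.mulVec v = 0 → ρ₀.mat.mulVec v = 0)
    (hcomm : Commute ρ₀.mat ρ₁.mat) :
    ∃ (n : ℕ) (E : POVM d n),
      klInformation (E.prob ρ₀) (E.prob ρ₁) = umegakiInformation ρ₀ ρ₁ := by
  set s := (finite_real_spectrum (A := ρ₀.mat)).toFinset
  set t := (finite_real_spectrum (A := ρ₁.mat)).toFinset
  have hPQ := fun x y => hcomm.spectralProjection x y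
  set P := ρ₀.mat.spectralProjection with hP
  set Q := ρ₁.mat.spectralProjection with hQ
  obtain ⟨n, e, E, hE⟩ := POVM.exists_of_fintype (ι := s × t) (fun k => P k.1 * Q k.2)
    (fun k => by
      have h : P k.1 * Q k.2 = (P k.1 * Q k.2)ᴴ * (P k.1 * Q k.2) := by
        rw [conjTranspose_mul, (isHermitian_spectralProjection _ _).eq,
          (isHermitian_spectralProjection _ _).eq, ← hP, ← hQ, ← (hPQ _ _).eq,
          Matrix.mul_assoc, ← Matrix.mul_assoc (Q _), ← (hPQ _ _).eq, Matrix.mul_assoc (P _) (Q _),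
          spectralProjection_mul_self, ← Matrix.mul_assoc, spectralProjection_mul_self]
      rw [h]
      exact posSemidef_conjTranspose_mul_self _)
    (by
      rw [Fintype.sum_prod_type]
      simp only [← Finset.mul_sum, ← Finset.sum_mul]
      rw [Finset.sum_coe_sort s P, Finset.sum_coe_sort t Q,
        ρ₀.posSemidef.isHermitian.sum_spectralProjection,
        ρ₁.posSemidef.isHermitian.sum_spectralProjection, Matrix.one_mul])
  have hA (f : ℝ → ℝ) (k : Fin n) : cfc f ρ₀.mat * E.effect k = f (e k).1 • E.effect k := by
    rw [hE, ← Matrix.mul_assoc, cfc_mul_spectralProjection, smul_mul_assoc]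
  have hB (f : ℝ → ℝ) (k : Fin n) : cfc f ρ₁.mat * E.effect k = f (e k).2 • E.effect k := by
    rw [hE, (hPQ _ _).eq, ← Matrix.mul_assoc, cfc_mul_spectralProjection, smul_mul_assoc]
  have hA1 (k : Fin n) : ρ₀.mat * E.effect k = ((e k).1 : ℝ) • E.effect k := by
    have := hA id k
    rwa [show cfc id ρ₀.mat = ρ₀.mat from
      cfc_id (p := IsSelfAdjoint) ℝ ρ₀.mat ρ₀.posSemidef.isHermitian] at this
  have hB1 (k : Fin n) : ρ₁.mat * E.effect k = ((e k).2 : ℝ) • E.effect k := by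
    have := hB id k
    rwa [show cfc id ρ₁.mat = ρ₁.mat from
      cfc_id (p := IsSelfAdjoint) ℝ ρ₁.mat ρ₁.posSemidef.isHermitian] at this
  have hp (k : Fin n) : E.prob ρ₀ k = (e k).1 * (E.effect k).trace.re := by
    rw [POVM.prob, hA1, trace_smul, Complex.smul_re, smul_eq_mul]
  have hq (k : Fin n) : E.prob ρ₁ k = (e k).2 * (E.effect k).trace.re := by
    rw [POVM.prob, hB1, trace_smul, Complex.smul_re, smul_eq_mul]
  refine ⟨n, E, ?_⟩
  rw [umegakiInformation, ← Matrix.mul_one (_ - _), ← E.sum_eq_one, Matrix.mul_sum, trace_sum,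
    Complex.re_sum, klInformation]
  refine Finset.sum_congr rfl fun k _ => ?_
  rw [Matrix.sub_mul, Matrix.mul_assoc, Matrix.mul_assoc, hA, hB, mul_smul_comm, mul_smul_comm,
    hA1, trace_sub, Complex.sub_re]
  simp only [trace_smul, Complex.smul_re, smul_eq_mul]
  by_cases h0 : E.prob ρ₀ k = 0
  · rw [h0, ← hp, h0]
    ring
  · have h1 : E.prob ρ₁ k ≠ 0 := fun h => h0 (E.prob_eq_zero hker h)
    rw [hp] at h0 ⊢
    rw [hq] at h1 ⊢
    rw [mul_div_mul_right _ _ (right_ne_zero_of_mul h0),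
      Real.log_div (left_ne_zero_of_mul h0) (left_ne_zero_of_mul h1)]
    ring

end Commuting

/-! ### The supremum over all measurements -/

theorem quantumKullback_le {d : Type*} [Fintype d] [DecidableEq d] {ρ₀ ρ₁ : DensityMatrix d}
    {C : ℝ} (h : ∀ (n : ℕ) (E : POVM d n), klInformation (E.prob ρ₀) (E.prob ρ₁) ≤ C) :
    quantumKullback ρ₀ ρ₁ ≤ C := by
  -- The one-outcome POVM shows that the set is nonempty.
  refine csSup_le ⟨_, 1, ⟨fun _ => 1, fun _ => PosSemidef.one, by simp⟩, rfl⟩ ?_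
  rintro x ⟨n, E, rfl⟩
  exact h n E

theorem mainTheorem4 {d : Type*} [Fintype d] [DecidableEq d] (ρ₀ ρ₁ : DensityMatrix d)
    (hker : ∀ v : d → ℂ, ρ₁.mat.mulVec v = 0 → ρ₀.mat.mulVec v = 0) :
    (∀ (n : ℕ) (E : POVM d n),
      klInformation (E.prob ρ₀) (E.prob ρ₁) ≤ umegakiInformation ρ₀ ρ₁) ∧
    quantumKullback ρ₀ ρ₁ ≤ umegakiInformation ρ₀ ρ₁ ∧
    (quantumKullback ρ₀ ρ₁ = umegakiInformation ρ₀ ρ₁ ↔ Commute ρ₀.mat ρ₁.mat) ∧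
    ((∃ (n : ℕ) (E : POVM d n),
      klInformation (E.prob ρ₀) (E.prob ρ₁) = umegakiInformation ρ₀ ρ₁) ↔
        Commute ρ₀.mat ρ₁.mat) := by
  have hle : ∀ (n : ℕ) (E : POVM d n),
      klInformation (E.prob ρ₀) (E.prob ρ₁) ≤ umegakiInformation ρ₀ ρ₁ :=
    fun _ E => klInformation_le_umegakiInformation hker E
  refine ⟨hle, quantumKullback_le hle, ⟨fun h => ?_, fun h => ?_⟩, fun h => ?_,
    exists_klInformation_eq_of_commute hker⟩
  · by_contra hcomm
    -- The gap `ε` must be uniform in `n` and `E`: strict inequality for each POVM would not bound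
    -- the supremum away.
    obtain ⟨ε, hε, hgap⟩ := exists_pos_klInformation_add_le hker hcomm
    have := quantumKullback_le fun n E => le_sub_iff_add_le.2 (hgap n E)
    linarith
  · obtain ⟨n, E, hE⟩ := exists_klInformation_eq_of_commute hker h
    refine le_antisymm (quantumKullback_le hle) ?_
    rw [← hE]
    refine le_csSup ⟨umegakiInformation ρ₀ ρ₁, ?_⟩ ⟨n, E, rfl⟩
    rintro x ⟨m, F, rfl⟩
    exact hle m F
  · by_contra hcomm
    obtain ⟨ε, hε, hgap⟩ := exists_pos_klInformation_add_le hker hcomm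
    obtain ⟨n, E, hE⟩ := h
    linarith [hgap n E]
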